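/- For an integer $n\ge 2$ and $\tau=\frac{1}{2(n-1)}$ let the flower game $G^{\tau,n}$ be the following Bayesian persuasion problem. The state $\omega\in[n]$ has the uniform prior $\mu(i)=\frac1n$. The receiver's actions are $a_j$ ($j\in[n]$) and $a_{(jl)}$ ($j\ne l$ in $[n]$). The receiver's utility vectors over states are $e_j$ for $a_j$ and $e_j+\tau\mathbf 1-e_l$ for $a_{(jl)}$; the sender's are $e_j$ for $a_j$ and $\mathbf 0$ for $a_{(jl)}$. A signaling scheme with finite signal set $S$ is a map $\pi:[n]\to\Delta^S$; it induces a joint law $p^\pi$ of state and signal, signal probabilities $p^\pi(s)$ and posteriors $y^\pi_s$. At a state distribution $y$ the receiver takes an action $a(y)$ that maximizes the receiver's expected utility at $y$ and, among the maximizers, the sender's expected utility at $y$ (remaining ties are broken by an arbitrary fixed rule). The known-commitment value is $BPR(\pi)=\mathbb E_{(\omega,s)\sim p^\pi}[u_S(\omega,a(y^\pi_s))]$. In round $k\ge1$ of the inference setting the receiver, on seeing $s$, takes the action $a(\hat y^\pi_{s,k})$, where $\hat y^\pi_{s,k}$ is the empirical distribution of the states seen with signal $s$ among one initial sample from $y^\pi_s$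 and $k-1$ independent samples from $p^\pi$ (independent of the initial sample and of the current round), and $IR_k(\pi)=\mathbb E_{(\omega,s)\sim p^\pi}\,\mathbb E[u_S(\omega,a(\hat y^\pi_{s,k}))]$. **Theorem.** The maximum $\max_{\pi'}BPR(\pi')$ over all signaling schemes with finite signal sets is attained. There are universal constants $c,\varepsilon_0>0$ such that for every $n\ge2$, every $\varepsilon\in(0,\varepsilon_0]$, every signaling scheme $\pi$ (with any finite signal set) that is $\varepsilon$-optimal in the known-commitment setting of $G^{1/(2(n-1)),n}$, i.e. $BPR(\pi)\ge\max_{\pi'}BPR(\pi')-\varepsilon$, and every $k\ge1$: if $$IR_k(\pi)\ge\max_{\pi'}BPR(\pi')-\varepsilon,\quad\text{then}\quad k\ge c\cdot\frac{n}{\varepsilon^2\left(\varepsilon+\frac1n\right)}.$$ In particular, there is a universal constant $c'>0$ such that for every $n\ge2$, with $\varepsilon=\frac1n$ (and without requiring $\varepsilon\le\varepsilon_0$), the same hypotheses imply $k\ge c'n^4$. -/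

import Mathlib

open Finset

/-- A Bayesian persuasion problem with finite state set `Ω` and finite action set `A`. -/
structure PersuasionGame (Ω A : Type*) [Fintype Ω] where
  /-- the prior `μ` on states -/
  prior : Ω → ℝ
  prior_mem : prior ∈ stdSimplex ℝ Ω
  /-- the sender's utility `u_S` -/
  uS : Ω → A → ℝ
  /-- the receiver's utility `u_R` -/
  uR : Ω → A → ℝ

/-- `π ω s` is the probability of sending signal `s` in state `ω`. -/
def IsScheme {Ω S : Type*} [Fintype S] (π : Ω → S → ℝ) : Prop :=
  ∀ ω, π ω ∈ stdSimplex ℝ S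

namespace PersuasionGame

section General

variable {Ω A S : Type*} [Fintype Ω] [Fintype S] (G : PersuasionGame Ω A)

/-- `⟨u_S^a, y⟩`, the sender's expected utility of action `a` under the state distribution `y`. -/
def senderValue (y : Ω → ℝ) (a : A) : ℝ := ∑ ω, y ω * G.uS ω a

/-- `⟨u_R^a, y⟩`, the receiver's expected utility of `a` under the state distribution `y`. -/
def receiverValue (y : Ω → ℝ) (a : A) : ℝ := ∑ ω, y ω * G.uR ω a

/-- `a ∈ argmax_b ⟨u_R^b, y⟩`. -/
def IsBestResponse (y : Ω → ℝ) (a : A) : Prop :=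
  ∀ b, G.receiverValue y b ≤ G.receiverValue y a

/-- The map `y ↦ act y` is an admissible behaviour of the receiver: at every state distribution `y`
the action `act y` is a best response, and among all best responses at `y` it is one with the
largest sender value at `y`. Ties that remain after this are resolved in an arbitrary way. -/
def IsReceiverRule (act : (Ω → ℝ) → A) : Prop :=
  ∀ y ∈ stdSimplex ℝ Ω, G.IsBestResponse y (act y) ∧
    ∀ b, G.IsBestResponse y b → G.senderValue y b ≤ G.senderValue y (act y)

/-- The joint distribution `p^π` of state and signal. -/
def joint (π : Ω → S → ℝ) (x : Ω × S) : ℝ := G.prior x.1 * π x.1 x.2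

/-- The marginal probability `p^π(s)` of the signal `s`. -/
def signalProb (π : Ω → S → ℝ) (s : S) : ℝ := ∑ ω, G.joint π (ω, s)

/-- The posterior `y_s^π` (it has a meaning, and is used with nonzero weight, only for signals of
positive probability). -/
noncomputable def posterior (π : Ω → S → ℝ) (s : S) : Ω → ℝ :=
  fun ω => G.joint π (ω, s) / G.signalProb π s

/-- The sender's expected utility when the receiver knows the scheme `π`. -/
noncomputable def BPR (act : (Ω → ℝ) → A) (π : Ω → S → ℝ) : ℝ :=
  ∑ ω, ∑ s, G.joint π (ω, s) * G.uS ω (act (G.posterior π s))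

/-- The known-commitment values of all schemes, over all finite signal sets. -/
def bprValues (act : (Ω → ℝ) → A) : Set ℝ :=
  {v | ∃ (m : ℕ) (π : Ω → Fin m → ℝ), IsScheme π ∧ v = G.BPR act π}

/-- `max_π BPR(π)`, the maximum being over all schemes with any finite signal set. -/
noncomputable def maxBPR (act : (Ω → ℝ) → A) : ℝ := sSup (G.bprValues act)

end General

section Inference

variable {Ω A S : Type*} [Fintype Ω] [DecidableEq Ω] [Fintype S] [DecidableEq S]
  (G : PersuasionGame Ω A)

/-- The receiver's count of `(ω, s)` after the initial sample `ω₀` for the signal `s` and the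
observed pairs `z 0, …, z (m - 1)`. -/
def count {m : ℕ} (s : S) (ω₀ : Ω) (z : Fin m → Ω × S) (ω : Ω) : ℕ :=
  #{i | z i = (ω, s)} + if ω₀ = ω then 1 else 0

/-- The receiver's empirical posterior for the signal `s`. -/
noncomputable def estimate {m : ℕ} (s : S) (ω₀ : Ω) (z : Fin m → Ω × S) : Ω → ℝ :=
  fun ω => (count s ω₀ z ω : ℝ) / ∑ ω', (count s ω₀ z ω' : ℝ)

/-- The expectation of `f` at the receiver's estimate of the posterior of `s` in round `k`: before
that round there were one initial sample from the posterior of `s` and, independently,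
`k - 1` independent samples from `p^π`, so that the counts of the latter
have the multinomial law with parameters `k - 1` and `p^π`. -/
noncomputable def estimateExp (π : Ω → S → ℝ) (k : ℕ) (s : S) (f : (Ω → ℝ) → ℝ) : ℝ :=
  ∑ z : Fin (k - 1) → Ω × S, ∑ ω₀ : Ω,
    (∏ i, G.joint π (z i)) * G.posterior π s ω₀ * f (estimate s ω₀ z)

/-- The sender's expected utility `IR_k(π)` in round `k` of the inference setting. -/
noncomputable def IR (act : (Ω → ℝ) → A) (k : ℕ) (π : Ω → S → ℝ) : ℝ :=
  ∑ ω, ∑ s, G.joint π (ω, s) * G.estimateExp π k s (fun y => G.uS ω (act y))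

end Inference

end PersuasionGame

/-- The actions of the flower game: `Sum.inl j` is `a_j`, and `Sum.inr (j, k)` with `j ≠ k` is
`a_(jk)`. -/
abbrev FlowerAction (n : ℕ) : Type := Fin n ⊕ {q : Fin n × Fin n // q.1 ≠ q.2}

/-- The flower game `G^{τ,n}`: uniform prior on `n` states; the receiver's utility vector is `e_j`
for `a_j` and `e_j + τ𝟏 - e_k` for `a_(jk)`, the sender's is `e_j` for `a_j` and `0` for
`a_(jk)`. -/
noncomputable def flowerGame (τ : ℝ) (n : ℕ) [NeZero n] :
    PersuasionGame (Fin n) (FlowerAction n) where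
  prior := fun _ => 1 / n
  prior_mem := by
    refine ⟨fun _ => by positivity, ?_⟩
    have h : (n : ℝ) ≠ 0 := Nat.cast_ne_zero.mpr (NeZero.ne n)
    simp [h]
  uS := fun ω a => match a with
    | Sum.inl j => if ω = j then 1 else 0
    | Sum.inr _ => 0
  uR := fun ω a => match a with
    | Sum.inl j => if ω = j then 1 else 0
    | Sum.inr q => (if ω = q.1.1 then 1 else 0) + τ - (if ω = q.1.2 then 1 else 0)

/-- The flower game `G^{1/(2(n-1)),n}`, for `n ≥ 2`. -/
noncomputable abbrev standardFlower (n : ℕ) [NeZero n] :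
    PersuasionGame (Fin n) (FlowerAction n) :=
  flowerGame (1 / (2 * ((n : ℝ) - 1))) n

/-! ### Anticoncentration for sums of independent samples. -/

section Anticoncentration

variable {α : Type*} [Fintype α] (w : α → ℝ)

/-! The receiver plays some `a_j` only at estimates with every coordinate at least `τ`
(`le_of_act_eq_inl`). The slacks `y l - τ` over `l ≠ j` add up to `1/2 - y j`, so the optimum is
`1/2`, and near-optimality leaves total slack `O(ε)` over `n - 1` states. Some signal `s`, of
probability `p`, is good both with known commitment and under inference (`exists_signal_value_ge`),
and some `l` has slack `O(ε/n)` there.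

One falsely low estimate of `y l` costs the sender everything. Per sample, the count of `(l, s)`
minus `τ` times the count of `s` has mean `O(p ε/n)` and second moment at least of order `p/n`. By
`exp_le_prob_frequency_le` the total is nonpositive with constant probability unless `k` is at least
of order `n/(p ε²)`. Since `y j ≥ 1/3` and the prior mass of `j` is `1/n`, also `p ≤ 3/n`. This
gives `k` of order at least `n²/ε²`, which is stronger than the stated bound. -/

/-- A sum of `m` independent copies of a bounded variable `W` with a nonnegative mean that is small
compared with its standard deviation is nonpositive with probability bounded below. -/
theorem exp_le_prob_sum_nonpos (hw : ∀ x, 0 ≤ w x) (hw1 : ∑ x, w x = 1) (W : α → ℝ)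
    (hW : ∀ x, |W x| ≤ 1) (m : ℕ) (hμ : 0 ≤ ∑ x, w x * W x)
    (hv : 1 ≤ m * ∑ x, w x * W x ^ 2)
    (hμv : 16 * m * (∑ x, w x * W x) ^ 2 ≤ ∑ x, w x * W x ^ 2) :
    Real.exp (-11) / 4 ≤
      ∑ z : Fin m → α, (∏ i, w (z i)) * (if ∑ i, W (z i) ≤ 0 then 1 else 0) := by
  set μ := ∑ x, w x * W x with hμdef
  set v := ∑ x, w x * W x ^ 2 with hvdef
  set b : ℝ := 1 / √(m * v) with hb
  have hs : 1 ≤ √(m * v) := by rwa [Real.one_le_sqrt]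
  have hb0 : 0 < b := by positivity
  have hb1 : b ≤ 1 := by rw [hb, div_le_one (by positivity)]; exact hs
  have hb2 : b ^ 2 * (m * v) = 1 := by
    rw [hb, div_pow, Real.sq_sqrt (by linarith), one_pow, one_div_mul_cancel (by linarith)]
  have hm0 : (0 : ℝ) ≤ m := Nat.cast_nonneg m
  have hbμ : 4 * (b * μ * m) ≤ 1 := by
    refine le_of_sq_le_sq ?_ zero_le_one
    calc (4 * (b * μ * m)) ^ 2 = b ^ 2 * m * (16 * m * μ ^ 2) := by ring
      _ ≤ b ^ 2 * m * v := by gcongr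
      _ = 1 ^ 2 := by linarith
  have hP : ∀ z : Fin m → α, 0 ≤ ∏ i, w (z i) := fun z => prod_nonneg fun i _ => hw _
  have hbW : ∀ x, |b * W x| ≤ 1 := fun x => by
    rw [abs_mul, abs_of_pos hb0]
    exact mul_le_one₀ hb1 (abs_nonneg _) (hW x)
  -- A Paley–Zygmund argument: `T` has mean at least `3/2` but is at most `1` where the sum is
  -- positive, so the complementary event carries `T`-mass at least `1/2`. Cauchy–Schwarz and a
  -- bound on the second moment of `T` turn this into a probability.
  set T : (Fin m → α) → ℝ := fun z => ∏ i, (1 - b * W (z i)) ^ 2 with hT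
  set I : (Fin m → α) → ℝ := fun z => if ∑ i, W (z i) ≤ 0 then 1 else 0 with hI
  have hI0 : ∀ z, 0 ≤ I z := fun z => by simp only [hI]; split_ifs <;> norm_num
  have htotal : ∑ z : Fin m → α, ∏ i, w (z i) = 1 := by rw [← Fintype.sum_pow, hw1, one_pow]
  have hmoment : ∑ x, w x * (1 - b * W x) ^ 2 = 1 + (b ^ 2 * v - 2 * b * μ) := by
    calc ∑ x, w x * (1 - b * W x) ^ 2
        = ∑ x, (w x + (b ^ 2 * (w x * W x ^ 2) - 2 * b * (w x * W x))) :=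
          sum_congr rfl fun x _ => by ring
      _ = 1 + (b ^ 2 * v - 2 * b * μ) := by
          rw [sum_add_distrib, sum_sub_distrib, ← mul_sum, ← mul_sum, hw1]
  have hfirst : 3 / 2 ≤ ∑ z, (∏ i, w (z i)) * T z := by
    have h1 : ∑ z, (∏ i, w (z i)) * T z = (1 + (b ^ 2 * v - 2 * b * μ)) ^ m := by
      simp only [hT, ← prod_mul_distrib]
      rw [← Fintype.sum_pow (fun x => w x * (1 - b * W x) ^ 2)]
      congr 1
    have h2 : 0 ≤ 1 + (b ^ 2 * v - 2 * b * μ) := by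
      rw [← hmoment]
      exact sum_nonneg fun x _ => mul_nonneg (hw x) (sq_nonneg _)
    rw [h1]
    refine le_trans ?_ (one_add_mul_le_pow (by linarith) m)
    linarith
  have hsecond : ∑ z, (∏ i, w (z i)) * T z ^ 2 ≤ Real.exp 11 := by
    have h1 : ∑ z, (∏ i, w (z i)) * T z ^ 2 = (∑ x, w x * (1 - b * W x) ^ 4) ^ m := by
      rw [Fintype.sum_pow]
      refine sum_congr rfl fun z _ => ?_
      simp only [hT]
      rw [← prod_pow, ← prod_mul_distrib]
      exact prod_congr rfl fun i _ => by ring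
    have h2 : ∑ x, w x * (1 - b * W x) ^ 4 ≤ 1 + 11 * (b ^ 2 * v) := by
      have h3 : ∑ x, w x * (1 - b * W x) ^ 4 ≤
          ∑ x, (w x - 4 * b * (w x * W x) + 11 * b ^ 2 * (w x * W x ^ 2)) := by
        refine sum_le_sum fun x _ => ?_
        obtain ⟨hl, hu⟩ := abs_le.mp (hbW x)
        -- With `x = b * W x`, the difference of the two sides is `x² (1 + x) (5 - x)`, nonnegative
        -- for `|x| ≤ 1`.
        have h4 : (1 - b * W x) ^ 4 ≤ 1 - 4 * (b * W x) + 11 * (b * W x) ^ 2 := by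
          have : 0 ≤ (b * W x) ^ 2 * ((1 + b * W x) * (5 - b * W x)) :=
            mul_nonneg (sq_nonneg _) (mul_nonneg (by linarith) (by linarith))
          linear_combination this
        calc w x * (1 - b * W x) ^ 4 ≤ w x * (1 - 4 * (b * W x) + 11 * (b * W x) ^ 2) :=
              mul_le_mul_of_nonneg_left h4 (hw x)
          _ = _ := by ring
      rw [sum_add_distrib, sum_sub_distrib, ← mul_sum, ← mul_sum, hw1] at h3
      have : 0 ≤ b * μ := by positivity
      linarith
    rw [h1]
    calc (∑ x, w x * (1 - b * W x) ^ 4) ^ m ≤ (Real.exp (11 * (b ^ 2 * v))) ^ m := by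
          refine pow_le_pow_left₀ (sum_nonneg fun x _ => mul_nonneg (hw x) (by positivity)) ?_ m
          linarith [Real.add_one_le_exp (11 * (b ^ 2 * v))]
      _ = Real.exp 11 := by
          rw [← Real.exp_nat_mul]
          congr 1
          linear_combination 11 * hb2
  have hsplit : ∑ z, (∏ i, w (z i)) * T z ≤ 1 + ∑ z, (∏ i, w (z i)) * T z * I z := by
    rw [← htotal, ← sum_add_distrib]
    refine sum_le_sum fun z _ => ?_
    by_cases hz : ∑ i, W (z i) ≤ 0
    · simp only [hI, if_pos hz]; linarith [hP z]
    · have hT1 : T z ≤ 1 := by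
        have : T z ≤ ∏ i, Real.exp (-(b * W (z i))) ^ 2 := by
          refine prod_le_prod (fun i _ => sq_nonneg _) fun i _ => ?_
          refine pow_le_pow_left₀ (by linarith [(abs_le.mp (hbW (z i))).2]) ?_ 2
          linarith [Real.add_one_le_exp (-(b * W (z i)))]
        refine this.trans ?_
        rw [prod_pow, ← Real.exp_sum]
        refine pow_le_one₀ (Real.exp_pos _).le (Real.exp_le_one_iff.mpr ?_)
        rw [sum_neg_distrib, ← mul_sum]
        have := mul_pos hb0 (not_le.mp hz)
        linarith
      simp only [hI, if_neg hz]
      nlinarith [hP z]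
  have hcs : (∑ z, (∏ i, w (z i)) * T z * I z) ^ 2 ≤
      (∑ z, (∏ i, w (z i)) * T z ^ 2) * ∑ z, (∏ i, w (z i)) * I z := by
    refine sum_sq_le_sum_mul_sum_of_sq_le_mul _ (fun z _ => mul_nonneg (hP z) (sq_nonneg _))
      (fun z _ => mul_nonneg (hP z) (hI0 z)) fun z _ => ?_
    have : I z ^ 2 = I z := by simp only [hI]; split_ifs <;> norm_num
    rw [mul_pow, this]
    exact le_of_eq (by ring)
  have hQ : 0 ≤ ∑ z, (∏ i, w (z i)) * I z := sum_nonneg fun z _ => mul_nonneg (hP z) (hI0 z)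
  have h4 : 1 / 4 ≤ Real.exp 11 * ∑ z, (∏ i, w (z i)) * I z := by
    have := mul_le_mul_of_nonneg_right hsecond hQ
    nlinarith
  rw [Real.exp_neg]
  have he := Real.exp_pos 11
  rw [inv_eq_one_div, div_div, div_le_iff₀ (by positivity)]
  linarith

/-- The same bound when the positive values of the summands come from a single rare atom. -/
theorem exp_le_prob_sum_nonpos_of_atom [DecidableEq α] (hw : ∀ x, 0 ≤ w x)
    (hw1 : ∑ x, w x = 1) (W : α → ℝ) (a : α) (hW : ∀ x, x ≠ a → W x ≤ 0) (ha : w a ≤ 1 / 2)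
    (m : ℕ) (hm : m * w a ≤ 4) :
    Real.exp (-8) ≤
      ∑ z : Fin m → α, (∏ i, w (z i)) * (if ∑ i, W (z i) ≤ 0 then 1 else 0) := by
  have hlog : Real.exp (-(2 * w a)) ≤ 1 - w a := by
    rw [← Real.le_log_iff_exp_le (by linarith)]
    have h := Real.one_sub_inv_le_log_of_pos (x := 1 - w a) (by linarith)
    refine le_trans ?_ h
    have : (1 - w a)⁻¹ ≤ 1 + 2 * w a := by
      rw [inv_le_iff_one_le_mul₀ (by linarith)]
      nlinarith [hw a]
    linarith
  have hsum : ∑ x, w x * (if x = a then 0 else 1) = 1 - w a := by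
    calc ∑ x, w x * (if x = a then 0 else 1) = ∑ x, (w x - if x = a then w x else 0) :=
          sum_congr rfl fun x _ => by split_ifs <;> ring
      _ = 1 - w a := by rw [sum_sub_distrib, hw1, sum_ite_eq' univ a w, if_pos (mem_univ a)]
  -- It suffices that no sample hits `a`, which has probability `(1 - w a) ^ m`.
  calc Real.exp (-8) ≤ Real.exp (-(2 * w a)) ^ m := by
        rw [← Real.exp_nat_mul, Real.exp_le_exp]; linarith
    _ ≤ (∑ x, w x * (if x = a then 0 else 1)) ^ m := by
        rw [hsum]; exact pow_le_pow_left₀ (Real.exp_pos _).le hlog m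
    _ = ∑ z : Fin m → α, ∏ i, w (z i) * (if z i = a then 0 else 1) := Fintype.sum_pow _ _
    _ ≤ _ := by
        refine sum_le_sum fun z _ => ?_
        rw [prod_mul_distrib]
        refine mul_le_mul_of_nonneg_left ?_ (prod_nonneg fun i _ => hw _)
        by_cases hz : ∃ i, z i = a
        · obtain ⟨i, hi⟩ := hz
          rw [prod_eq_zero (mem_univ i) (by simp [hi])]
          split_ifs <;> norm_num
        · push Not at hz
          rw [if_pos (sum_nonpos fun i _ => hW _ (hz i))]
          simp [hz]

/-- For independent samples from a joint law `w`, the empirical frequency of `l` among the samples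
with second coordinate `s` is at most `τ` with probability bounded below, provided its conditional
probability exceeds `τ` by at most the order of the standard deviation. -/
theorem exp_le_prob_frequency_le {Ω S : Type*} [Fintype Ω] [Fintype S] [DecidableEq Ω]
    [DecidableEq S] (w : Ω × S → ℝ) (hw : ∀ x, 0 ≤ w x) (hw1 : ∑ x, w x = 1) (s : S) (l : Ω)
    (τ : ℝ) (hτ0 : 0 ≤ τ) (hτ : τ ≤ 1 / 2) (hl : τ * ∑ ω, w (ω, s) ≤ w (l, s))
    (hl' : w (l, s) ≤ 1 / 2) (m : ℕ)
    (hm : 16 * m * (w (l, s) - τ * ∑ ω, w (ω, s)) ^ 2 ≤ w (l, s) / 4) :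
    Real.exp (-11) / 4 ≤ ∑ z : Fin m → Ω × S, (∏ i, w (z i)) *
      (if ∑ i, ((if z i = (l, s) then 1 else 0) - τ * (if (z i).2 = s then 1 else 0)) ≤ 0
        then 1 else 0) := by
  set p := ∑ ω, w (ω, s) with hp
  set W : Ω × S → ℝ := fun x =>
    (if x = (l, s) then 1 else 0) - τ * (if x.2 = s then 1 else 0) with hW
  have hatom : ∑ x, (if x = (l, s) then w x else 0) = w (l, s) := by simp
  have hfiber : ∑ x, (if x.2 = s then w x else 0) = p := by
    rw [Fintype.sum_prod_type]; simp [hp]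
  have hmean : ∑ x, w x * W x = w (l, s) - τ * p := by
    rw [← hatom, ← hfiber, mul_sum, ← sum_sub_distrib]
    refine sum_congr rfl fun x _ => ?_
    simp only [hW]
    split_ifs <;> ring
  have hsq : ∑ x, w x * W x ^ 2 = (1 - 2 * τ) * w (l, s) + τ ^ 2 * p := by
    rw [← hatom, ← hfiber, mul_sum, mul_sum, ← sum_add_distrib]
    refine sum_congr rfl fun x _ => ?_
    simp only [hW]
    by_cases hx : x = (l, s)
    · simp only [hx, if_true]; ring
    · simp only [hx, if_false]; split_ifs <;> ring
  have hle : w (l, s) ≤ p := single_le_sum (f := fun ω => w (ω, s)) (fun ω _ => hw _) (mem_univ l)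
  have hvar : w (l, s) / 4 ≤ ∑ x, w x * W x ^ 2 := by
    rw [hsq]
    have h1 := mul_le_mul_of_nonneg_left hle (sq_nonneg τ)
    have h2 : 0 ≤ w (l, s) * ((1 / 2 - τ) * (3 / 2 - τ)) :=
      mul_nonneg (hw _) (mul_nonneg (by linarith) (by linarith))
    linarith
  -- If the total second moment is at least `1`, the tilting bound applies. Otherwise `hvar` makes
  -- the expected number of hits of `(l, s)` less than `4`, and having no hit at all is likely
  -- enough.
  by_cases hv : 1 ≤ m * ∑ x, w x * W x ^ 2
  · refine exp_le_prob_sum_nonpos w hw hw1 W (fun x => ?_) m ?_ hv ?_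
    · rw [abs_le]
      by_cases hx : x = (l, s)
      · simp only [hW, hx, if_true]; constructor <;> linarith
      · simp only [hW, hx, if_false]
        split_ifs <;> constructor <;> linarith
    · rw [hmean]; linarith
    · rw [hmean]; exact hm.trans hvar
  · refine le_trans ?_
      (exp_le_prob_sum_nonpos_of_atom w hw hw1 W (l, s) (fun x hx => ?_) hl' m ?_)
    · have h1 : Real.exp (-11) ≤ Real.exp (-8) := Real.exp_le_exp.mpr (by norm_num)
      linarith [Real.exp_pos (-11)]
    · simp only [hW, hx, if_false]
      split_ifs <;> linarith
    · have := mul_le_mul_of_nonneg_left hvar (Nat.cast_nonneg (α := ℝ) m)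
      linarith [not_le.mp hv]

end Anticoncentration

/-! ### Signal-wise form of the values, and the law of the estimate. -/

namespace PersuasionGame

section General

variable {Ω A S : Type*} [Fintype Ω] [Fintype S] (G : PersuasionGame Ω A) {π : Ω → S → ℝ}

theorem joint_nonneg (hπ : IsScheme π) (x : Ω × S) : 0 ≤ G.joint π x :=
  mul_nonneg (G.prior_mem.1 _) ((hπ _).1 _)

theorem sum_joint_snd (hπ : IsScheme π) (ω : Ω) : ∑ s, G.joint π (ω, s) = G.prior ω := by
  simp only [joint]
  rw [← mul_sum, (hπ ω).2, mul_one]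

theorem joint_le_prior (hπ : IsScheme π) (ω : Ω) (s : S) : G.joint π (ω, s) ≤ G.prior ω := by
  rw [← G.sum_joint_snd hπ ω]
  exact single_le_sum (f := fun s => G.joint π (ω, s)) (fun s _ => G.joint_nonneg hπ _)
    (mem_univ s)

theorem sum_joint (hπ : IsScheme π) : ∑ x, G.joint π x = 1 := by
  rw [Fintype.sum_prod_type, ← G.prior_mem.2]
  exact sum_congr rfl fun ω _ => G.sum_joint_snd hπ ω

theorem signalProb_nonneg (hπ : IsScheme π) (s : S) : 0 ≤ G.signalProb π s :=
  sum_nonneg fun _ _ => G.joint_nonneg hπ _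

theorem sum_signalProb (hπ : IsScheme π) : ∑ s, G.signalProb π s = 1 := by
  rw [← G.sum_joint hπ, Fintype.sum_prod_type_right]
  rfl

theorem joint_eq_signalProb_mul_posterior (hπ : IsScheme π) (ω : Ω) (s : S) :
    G.joint π (ω, s) = G.signalProb π s * G.posterior π s ω := by
  by_cases h : G.signalProb π s = 0
  · rw [h, zero_mul]
    exact (sum_eq_zero_iff_of_nonneg fun ω _ => G.joint_nonneg hπ (ω, s)).mp h ω (mem_univ ω)
  · rw [posterior, mul_div_cancel₀ _ h]

theorem posterior_mem (hπ : IsScheme π) {s : S} (hs : 0 < G.signalProb π s) :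
    G.posterior π s ∈ stdSimplex ℝ Ω := by
  refine ⟨fun ω => div_nonneg (G.joint_nonneg hπ _) hs.le, ?_⟩
  simp only [posterior]
  rw [← sum_div]
  exact div_self hs.ne'

theorem BPR_eq_sum_signalProb_mul (hπ : IsScheme π) (act : (Ω → ℝ) → A) :
    G.BPR act π =
      ∑ s, G.signalProb π s * G.senderValue (G.posterior π s) (act (G.posterior π s)) := by
  rw [BPR, sum_comm]
  refine sum_congr rfl fun s _ => ?_
  rw [senderValue, mul_sum]
  refine sum_congr rfl fun ω _ => ?_
  rw [G.joint_eq_signalProb_mul_posterior hπ, mul_assoc]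

end General

section Estimate

variable {Ω S : Type*} [Fintype Ω] [DecidableEq Ω] [DecidableEq S]

theorem sum_count {m : ℕ} (s : S) (ω₀ : Ω) (z : Fin m → Ω × S) :
    ∑ ω, (count s ω₀ z ω : ℝ) = ∑ i, (if (z i).2 = s then 1 else 0) + 1 := by
  simp only [count, Nat.cast_add, sum_add_distrib, card_filter, Nat.cast_sum, Nat.cast_ite,
    Nat.cast_one, Nat.cast_zero]
  congr 1
  · rw [sum_comm]
    refine sum_congr rfl fun i _ => ?_
    simp only [Prod.ext_iff, ite_and]
    simp
  · simp

theorem estimate_mem {m : ℕ} (s : S) (ω₀ : Ω) (z : Fin m → Ω × S) :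
    estimate s ω₀ z ∈ stdSimplex ℝ Ω := by
  have h : 0 < ∑ ω, (count s ω₀ z ω : ℝ) := by
    rw [sum_count]
    exact add_pos_of_nonneg_of_pos
      (sum_nonneg fun _ _ => by split_ifs <;> norm_num) one_pos
  refine ⟨fun ω => div_nonneg (Nat.cast_nonneg _) h.le, ?_⟩
  simp only [estimate]
  rw [← sum_div]
  exact div_self h.ne'

/-- If the initial sample is not `l` and the frequency of `l` among the later samples for `s` is at
most `τ`, then the estimate of the probability of `l` is below `τ`. -/
theorem estimate_lt {m : ℕ} {s : S} {ω₀ l : Ω} {z : Fin m → Ω × S} {τ : ℝ} (hτ : 0 < τ)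
    (h₀ : ω₀ ≠ l)
    (hz : ∑ i, ((if z i = (l, s) then 1 else 0) - τ * (if (z i).2 = s then 1 else 0)) ≤ 0) :
    estimate s ω₀ z l < τ := by
  have hc : (count s ω₀ z l : ℝ) = ∑ i, (if z i = (l, s) then 1 else 0) := by
    simp [count, h₀]
  have hn : (0 : ℝ) ≤ ∑ i, (if (z i).2 = s then 1 else 0) :=
    sum_nonneg fun i _ => by split_ifs <;> norm_num
  rw [sum_sub_distrib, ← mul_sum] at hz
  rw [estimate, sum_count, hc, div_lt_iff₀ (by linarith)]
  linarith

end Estimate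

section Inference

variable {Ω A S : Type*} [Fintype Ω] [DecidableEq Ω] [Fintype S] [DecidableEq S]
  (G : PersuasionGame Ω A) {π : Ω → S → ℝ}

/-- Given the signal, the estimate is independent of the current state, so the sender's payoff
averages to its value at the true posterior. -/
theorem IR_eq_sum_signalProb_mul (hπ : IsScheme π) (act : (Ω → ℝ) → A) (k : ℕ) :
    G.IR act k π = ∑ s, G.signalProb π s *
      G.estimateExp π k s (fun y => G.senderValue (G.posterior π s) (act y)) := by
  rw [IR, sum_comm]
  refine sum_congr rfl fun s _ => ?_
  simp only [senderValue, estimateExp, mul_sum]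
  rw [sum_comm]
  refine sum_congr rfl fun z _ => ?_
  rw [sum_comm]
  refine sum_congr rfl fun ω₀ _ => sum_congr rfl fun ω _ => ?_
  rw [G.joint_eq_signalProb_mul_posterior hπ ω s]
  ring

theorem estimateExp_mono (hπ : IsScheme π) (k : ℕ) {s : S} (hs : 0 < G.signalProb π s)
    {f g : (Ω → ℝ) → ℝ} (hfg : ∀ y ∈ stdSimplex ℝ Ω, f y ≤ g y) :
    G.estimateExp π k s f ≤ G.estimateExp π k s g :=
  sum_le_sum fun z _ => sum_le_sum fun ω₀ _ =>
    mul_le_mul_of_nonneg_left (hfg _ (estimate_mem s ω₀ z))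
      (mul_nonneg (prod_nonneg fun _ _ => G.joint_nonneg hπ _) ((G.posterior_mem hπ hs).1 ω₀))

theorem estimateExp_const (hπ : IsScheme π) (k : ℕ) {s : S} (hs : 0 < G.signalProb π s) (c : ℝ) :
    G.estimateExp π k s (fun _ => c) = c := by
  simp only [estimateExp]
  simp_rw [← sum_mul, ← mul_sum, (G.posterior_mem hπ hs).2, mul_one]
  rw [← Fintype.sum_pow, G.sum_joint hπ, one_pow, one_mul]

/-- If the estimate of the probability of `l` is likely to fall below `τ`, then a function that
vanishes where this happens has a small expectation. -/
theorem estimateExp_le (hπ : IsScheme π) (k : ℕ) {s : S} (hs : 0 < G.signalProb π s)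
    {f : (Ω → ℝ) → ℝ} {M τ κ : ℝ} {l : Ω} (hM : 0 ≤ M) (hτ : 0 < τ)
    (hf : ∀ y ∈ stdSimplex ℝ Ω, f y ≤ M) (hf0 : ∀ y ∈ stdSimplex ℝ Ω, y l < τ → f y ≤ 0)
    (hκ : κ ≤ ∑ z : Fin (k - 1) → Ω × S, (∏ i, G.joint π (z i)) *
      (if ∑ i, ((if z i = (l, s) then 1 else 0) - τ * (if (z i).2 = s then 1 else 0)) ≤ 0
        then 1 else 0)) :
    G.estimateExp π k s f ≤ M * (1 - (1 - G.posterior π s l) * κ) := by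
  obtain ⟨hy0, hy1⟩ := G.posterior_mem hπ hs
  set y := G.posterior π s with hy
  set I : (Fin (k - 1) → Ω × S) → ℝ := fun z =>
    if ∑ i, ((if z i = (l, s) then 1 else 0) - τ * (if (z i).2 = s then 1 else 0)) ≤ 0
        then 1 else 0 with hI
  have hyl : y l ≤ 1 := by
    rw [← hy1]; exact single_le_sum (fun ω _ => hy0 ω) (mem_univ l)
  have hother : ∑ ω, y ω * (if ω = l then 0 else 1) = 1 - y l := by
    calc ∑ ω, y ω * (if ω = l then 0 else 1) = ∑ ω, (y ω - if ω = l then y ω else 0) :=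
          sum_congr rfl fun x _ => by split_ifs <;> ring
      _ = 1 - y l := by rw [sum_sub_distrib, hy1, sum_ite_eq' univ l y, if_pos (mem_univ l)]
  -- The initial sample is independent of the later ones and differs from `l` with probability `1 -
  -- y l`; this is the factor in front of `κ`.
  calc G.estimateExp π k s f
      ≤ ∑ z : Fin (k - 1) → Ω × S, ∑ ω₀ : Ω,
          (∏ i, G.joint π (z i)) * y ω₀ * (M * (1 - (if ω₀ = l then 0 else 1) * I z)) := by
        refine sum_le_sum fun z _ => sum_le_sum fun ω₀ _ => ?_
        refine mul_le_mul_of_nonneg_left ?_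
          (mul_nonneg (prod_nonneg fun i _ => G.joint_nonneg hπ _) (hy0 ω₀))
        have hmem := estimate_mem s ω₀ z
        by_cases h₀ : ω₀ = l
        · simpa [h₀] using hf _ (estimate_mem s l z)
        · simp only [hI, h₀, if_false]
          split_ifs with hz
          · simpa using hf0 _ hmem (estimate_lt hτ h₀ hz)
          · simpa using hf _ hmem
    _ = ∑ z : Fin (k - 1) → Ω × S,
          (M * ∏ i, G.joint π (z i) - M * (1 - y l) * ((∏ i, G.joint π (z i)) * I z)) := by
        refine sum_congr rfl fun z _ => ?_
        rw [← hother]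
        calc _ = ∑ ω₀, (M * (∏ i, G.joint π (z i)) * y ω₀ - M * ((∏ i, G.joint π (z i)) * I z) *
              (y ω₀ * (if ω₀ = l then 0 else 1))) := sum_congr rfl fun ω₀ _ => by ring
          _ = _ := by rw [sum_sub_distrib, ← mul_sum, ← mul_sum, hy1]; ring
    _ = M * (1 - (1 - y l) * ∑ z, (∏ i, G.joint π (z i)) * I z) := by
        rw [sum_sub_distrib, ← mul_sum, ← mul_sum, ← Fintype.sum_pow, G.sum_joint hπ]
        ring
    _ ≤ _ := by
        have := mul_le_mul_of_nonneg_left hκ (mul_nonneg hM (sub_nonneg.mpr hyl))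
        linarith

end Inference

end PersuasionGame

/-! ### The flower game: optimal value and sample lower bound. -/

section Flower

open PersuasionGame

theorem sum_erase_sub_standardFlower {n : ℕ} (hn : 2 ≤ n) {y : Fin n → ℝ}
    (hy : y ∈ stdSimplex ℝ (Fin n)) (j : Fin n) :
    ∑ l ∈ univ.erase j, (y l - 1 / (2 * ((n : ℝ) - 1))) = 1 / 2 - y j := by
  have hn' : (2 : ℝ) ≤ n := by exact_mod_cast hn
  have h1 : ((n : ℝ) - 1) ≠ 0 := by linarith
  rw [sum_sub_distrib, sum_erase_eq_sub (mem_univ j), hy.2, sum_const,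
    card_erase_of_mem (mem_univ j), card_univ, Fintype.card_fin, nsmul_eq_mul, Nat.cast_sub (by omega), Nat.cast_one]
  field_simp
  ring

variable {n : ℕ} [NeZero n]

theorem flowerGame_senderValue_inl (τ : ℝ) (y : Fin n → ℝ) (j : Fin n) :
    (flowerGame τ n).senderValue y (Sum.inl j) = y j := by
  simp [senderValue, flowerGame]

theorem flowerGame_senderValue_inr (τ : ℝ) (y : Fin n → ℝ) (q : {q : Fin n × Fin n // q.1 ≠ q.2}) :
    (flowerGame τ n).senderValue y (Sum.inr q) = 0 := by
  simp [senderValue, flowerGame]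

theorem flowerGame_receiverValue_inl (τ : ℝ) (y : Fin n → ℝ) (j : Fin n) :
    (flowerGame τ n).receiverValue y (Sum.inl j) = y j := by
  simp [receiverValue, flowerGame]

theorem flowerGame_receiverValue_inr (τ : ℝ) {y : Fin n → ℝ} (hy : y ∈ stdSimplex ℝ (Fin n))
    (q : {q : Fin n × Fin n // q.1 ≠ q.2}) :
    (flowerGame τ n).receiverValue y (Sum.inr q) = y q.1.1 + τ - y q.1.2 := by
  simp [receiverValue, flowerGame, mul_sub, mul_add, sum_add_distrib, ← sum_mul, hy.2]

/-- For `l ≠ j`, the action `a_(jl)` strictly beats `a_j` exactly when `y l < τ`. The coordinate `j`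
itself is covered because it is the largest and another state exists. -/
theorem le_of_act_eq_inl {τ : ℝ} (hn : 2 ≤ n) {act : (Fin n → ℝ) → FlowerAction n}
    (hact : (flowerGame τ n).IsReceiverRule act) {y : Fin n → ℝ} (hy : y ∈ stdSimplex ℝ (Fin n))
    {j : Fin n} (hj : act y = Sum.inl j) : (∀ i, y i ≤ y j) ∧ ∀ l, τ ≤ y l := by
  have hbr := (hact y hy).1
  rw [hj] at hbr
  have hmax : ∀ i, y i ≤ y j := fun i => by
    simpa only [flowerGame_receiverValue_inl] using hbr (Sum.inl i)
  have hne : ∀ l, l ≠ j → τ ≤ y l := fun l hl => by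
    have := hbr (Sum.inr ⟨(j, l), hl.symm⟩)
    rw [flowerGame_receiverValue_inl, flowerGame_receiverValue_inr τ hy] at this
    linarith
  refine ⟨hmax, fun l => ?_⟩
  by_cases hl : l = j
  · have : Nontrivial (Fin n) := Fin.nontrivial_iff_two_le.mpr hn
    obtain ⟨i, hi⟩ := exists_ne j
    rw [hl]
    exact (hne i hi).trans (hmax i)
  · exact hne l hl

theorem le_half_of_act_eq_inl (hn : 2 ≤ n) {act : (Fin n → ℝ) → FlowerAction n}
    (hact : (standardFlower n).IsReceiverRule act) {y : Fin n → ℝ}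
    (hy : y ∈ stdSimplex ℝ (Fin n)) {j : Fin n} (hj : act y = Sum.inl j) : y j ≤ 1 / 2 := by
  have h := sum_erase_sub_standardFlower hn hy j
  have : 0 ≤ ∑ l ∈ univ.erase j, (y l - 1 / (2 * ((n : ℝ) - 1))) :=
    sum_nonneg fun l _ => sub_nonneg.mpr ((le_of_act_eq_inl hn hact hy hj).2 l)
  linarith

theorem senderValue_act_le_half (hn : 2 ≤ n) {act : (Fin n → ℝ) → FlowerAction n}
    (hact : (standardFlower n).IsReceiverRule act) {y : Fin n → ℝ}
    (hy : y ∈ stdSimplex ℝ (Fin n)) : (standardFlower n).senderValue y (act y) ≤ 1 / 2 := by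
  cases h : act y with
  | inl j => rw [flowerGame_senderValue_inl]; exact le_half_of_act_eq_inl hn hact hy h
  | inr q => rw [flowerGame_senderValue_inr]; norm_num

theorem BPR_le_half (hn : 2 ≤ n) {act : (Fin n → ℝ) → FlowerAction n}
    (hact : (standardFlower n).IsReceiverRule act) {S : Type*} [Fintype S] {π : Fin n → S → ℝ}
    (hπ : IsScheme π) : (standardFlower n).BPR act π ≤ 1 / 2 := by
  rw [BPR_eq_sum_signalProb_mul _ hπ]
  calc _ ≤ ∑ s, (standardFlower n).signalProb π s * (1 / 2) := by
        refine sum_le_sum fun s _ => ?_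
        rcases (signalProb_nonneg _ hπ s).eq_or_lt with h | h
        · rw [← h, zero_mul, zero_mul]
        · exact mul_le_mul_of_nonneg_left
            (senderValue_act_le_half hn hact (posterior_mem _ hπ h)) h.le
    _ = 1 / 2 := by rw [← sum_mul, sum_signalProb _ hπ, one_mul]

theorem half_mem_bprValues (hn : 2 ≤ n) {act : (Fin n → ℝ) → FlowerAction n}
    (hact : (standardFlower n).IsReceiverRule act) :
    (1 / 2 : ℝ) ∈ (standardFlower n).bprValues act := by
  have hn' : (2 : ℝ) ≤ n := by exact_mod_cast hn
  have h1 : (0 : ℝ) < n - 1 := by linarith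
  set τ : ℝ := 1 / (2 * ((n : ℝ) - 1)) with hτ
  have hτ0 : 0 < τ := by positivity
  have hτn : (n - 1) * τ = 1 / 2 := by rw [hτ]; field_simp
  have hτ2 : τ ≤ 1 / 2 := by nlinarith
  -- A symmetric doubly stochastic scheme: the posterior of `s` is `1/2` at `s` and `τ` elsewhere.
  -- There `a_s` ties with every `a_(sl)`, and the tie goes to the sender.
  set π : Fin n → Fin n → ℝ := fun ω s => (if ω = s then 1 / 2 - τ else 0) + τ with hπdef
  have hpos : ∀ ω s, 0 ≤ π ω s := fun ω s => by simp only [hπdef]; split_ifs <;> linarith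
  have hsum : ∀ ω, ∑ s, π ω s = 1 := fun ω => by
    simp [hπdef, sum_add_distrib]; linarith
  have hsum' : ∀ s, ∑ ω, π ω s = 1 := fun s => by
    simp [hπdef, sum_add_distrib]; linarith
  have hπ : IsScheme π := fun ω => ⟨hpos ω, hsum ω⟩
  have hjoint : ∀ ω s, (standardFlower n).joint π (ω, s) = 1 / n * π ω s := fun ω s => rfl
  have hprob : ∀ s, (standardFlower n).signalProb π s = 1 / n := fun s => by
    simp only [signalProb, hjoint]
    rw [← mul_sum, hsum', mul_one]
  have hpost : ∀ s, (standardFlower n).posterior π s = fun ω => π ω s := fun s => by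
    funext ω
    rw [posterior, hprob, hjoint, mul_div_cancel_left₀ _ (by positivity)]
  refine ⟨n, π, hπ, le_antisymm ?_ (BPR_le_half hn hact hπ)⟩
  rw [BPR_eq_sum_signalProb_mul _ hπ]
  calc (1 / 2 : ℝ) = ∑ s, (standardFlower n).signalProb π s * (1 / 2) := by
        rw [← sum_mul, sum_signalProb _ hπ, one_mul]
    _ ≤ _ := by
        refine sum_le_sum fun s _ => mul_le_mul_of_nonneg_left ?_ (signalProb_nonneg _ hπ s)
        rw [hpost]
        have hy : (fun ω => π ω s) ∈ stdSimplex ℝ (Fin n) := ⟨fun ω => hpos ω s, hsum' s⟩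
        have hself : π s s = 1 / 2 := by simp [hπdef]
        have hother : ∀ ω, ω ≠ s → π ω s = τ := fun ω h => by simp [hπdef, h]
        have hle : ∀ ω, π ω s ≤ 1 / 2 := fun ω => by
          by_cases h : ω = s
          · rw [h, hself]
          · rw [hother ω h]; exact hτ2
        have hge : ∀ ω, τ ≤ π ω s := fun ω => by
          by_cases h : ω = s
          · rw [h, hself]; exact hτ2
          · rw [hother ω h]
        have h := (hact _ hy).2 (Sum.inl s) fun b => ?_
        · rwa [flowerGame_senderValue_inl, hself] at h
        · rw [flowerGame_receiverValue_inl, hself]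
          cases b with
          | inl i => rw [flowerGame_receiverValue_inl]; exact hle i
          | inr q =>
            rw [flowerGame_receiverValue_inr _ hy]
            linarith [hle q.1.1, hge q.1.2]

theorem isGreatest_bprValues (hn : 2 ≤ n) {act : (Fin n → ℝ) → FlowerAction n}
    (hact : (standardFlower n).IsReceiverRule act) :
    IsGreatest ((standardFlower n).bprValues act) (1 / 2) :=
  ⟨half_mem_bprValues hn hact, by
    rintro _ ⟨m, π, hπ, rfl⟩
    exact BPR_le_half hn hact hπ⟩

theorem maxBPR_eq_half (hn : 2 ≤ n) {act : (Fin n → ℝ) → FlowerAction n}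
    (hact : (standardFlower n).IsReceiverRule act) : (standardFlower n).maxBPR act = 1 / 2 :=
  (isGreatest_bprValues hn hact).csSup_eq

/-- If the known-commitment and the inference values are both close to `1 / 2`, then so are the
values of some signal. -/
theorem exists_signal_value_ge {act : (Fin n → ℝ) → FlowerAction n}
    {S : Type*} [Fintype S] [DecidableEq S] {π : Fin n → S → ℝ} (hπ : IsScheme π) {ε : ℝ} {k : ℕ}
    (hB : 1 / 2 - ε ≤ (standardFlower n).BPR act π)
    (hI : 1 / 2 - ε ≤ (standardFlower n).IR act k π) :
    ∃ s, 0 < (standardFlower n).signalProb π s ∧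
      3 / 2 - 3 * ε ≤
        2 * (standardFlower n).senderValue ((standardFlower n).posterior π s)
            (act ((standardFlower n).posterior π s)) +
          (standardFlower n).estimateExp π k s
            (fun y => (standardFlower n).senderValue ((standardFlower n).posterior π s)
              (act y)) := by
  set G := standardFlower n
  by_contra! h
  rw [BPR_eq_sum_signalProb_mul _ hπ] at hB
  rw [IR_eq_sum_signalProb_mul _ hπ] at hI
  have hsum := G.sum_signalProb hπ
  obtain ⟨s₀, -, hs₀⟩ : ∃ s ∈ univ, 0 < G.signalProb π s := by
    by_contra! h0
    linarith [sum_nonpos h0]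
  -- Averaging over signals. The weight `2` on the known-commitment value ensures that a signal with
  -- `a_(jl)` at its posterior fails even under the trivial bound `1` on its inference value.
  have hlt : ∑ s, G.signalProb π s *
      (2 * G.senderValue (G.posterior π s) (act (G.posterior π s)) +
        G.estimateExp π k s (fun y => G.senderValue (G.posterior π s) (act y))) <
      ∑ s, G.signalProb π s * (3 / 2 - 3 * ε) := by
    refine sum_lt_sum (fun s _ => ?_) ⟨s₀, mem_univ _, mul_lt_mul_of_pos_left (h s₀ hs₀) hs₀⟩
    rcases (G.signalProb_nonneg hπ s).eq_or_lt with h0 | h0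
    · rw [← h0, zero_mul, zero_mul]
    · exact mul_le_mul_of_nonneg_left (h s h0).le h0.le
  rw [← sum_mul, hsum, one_mul] at hlt
  simp only [mul_add, sum_add_distrib, mul_left_comm _ (2 : ℝ)] at hlt
  rw [← mul_sum] at hlt
  linarith

/-- If `k` were smaller, the selected signal would lose at least `exp (-11) / 16` of its inference
value, more than the `3 * ε` that its combined value may lack. -/
theorem standardFlower_sample_lower_bound (hn : 2 ≤ n) {act : (Fin n → ℝ) → FlowerAction n}
    (hact : (standardFlower n).IsReceiverRule act) {ε : ℝ} (hε : 0 < ε)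
    (hε' : ε ≤ Real.exp (-11) / 100)
    {S : Type*} [Fintype S] [DecidableEq S] {π : Fin n → S → ℝ} (hπ : IsScheme π) {k : ℕ}
    (hB : 1 / 2 - ε ≤ (standardFlower n).BPR act π)
    (hI : 1 / 2 - ε ≤ (standardFlower n).IR act k π) :
    1 / 3456 * (n ^ 2 / ε ^ 2) ≤ (k : ℝ) := by
  by_contra! hk
  obtain ⟨s, hs, hval⟩ := exists_signal_value_ge hπ hB hI
  set G := standardFlower n with hG
  have hexp : Real.exp (-11) ≤ 1 := Real.exp_le_one_iff.mpr (by norm_num)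
  have hy := G.posterior_mem hπ hs
  set y := G.posterior π s with hydef
  have hn' : (2 : ℝ) ≤ n := by exact_mod_cast hn
  have hn1 : (0 : ℝ) < n - 1 := by linarith
  set τ : ℝ := 1 / (2 * ((n : ℝ) - 1)) with hτ
  have hτ0 : 0 < τ := by positivity
  have hτn : (n - 1) * τ = 1 / 2 := by rw [hτ]; field_simp
  have hτ2 : τ ≤ 1 / 2 := by nlinarith
  have hyle : ∀ i, y i ≤ 1 := fun i => by
    rw [← hy.2]; exact single_le_sum (fun ω _ => hy.1 ω) (mem_univ i)
  have hle : ∀ {M : ℝ}, 0 ≤ M → (∀ i, y i ≤ M) → ∀ a, G.senderValue y a ≤ M := by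
    intro M hM hyM a
    cases a with
    | inl i => rw [hG, flowerGame_senderValue_inl]; exact hyM i
    | inr q => rw [hG, flowerGame_senderValue_inr]; exact hM
  have hbound : ∀ {M : ℝ}, 0 ≤ M → (∀ i, y i ≤ M) →
      G.estimateExp π k s (fun y' => G.senderValue y (act y')) ≤ M := fun {M} hM hyM =>
    (G.estimateExp_mono hπ k hs fun y' _ => hle hM hyM (act y')).trans_eq
      (G.estimateExp_const hπ k hs M)
  cases hj : act y with
  | inr q =>
    rw [hj, hG, flowerGame_senderValue_inr, ← hG] at hval
    linarith [hbound zero_le_one hyle]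
  | inl j =>
    rw [hj, hG, flowerGame_senderValue_inl, ← hG] at hval
    obtain ⟨hmax, hpetal⟩ := le_of_act_eq_inl hn hact hy hj
    have hj2 := le_half_of_act_eq_inl hn hact hy hj
    have hhalf : ∀ i, y i ≤ 1 / 2 := fun i => (hmax i).trans hj2
    have hyj : 1 / 2 - 3 / 2 * ε ≤ y j := by linarith [hbound (by norm_num) hhalf]
    have hyj' : 1 / 3 ≤ y j := by linarith
    have hcard : ((univ.erase j).card : ℝ) = n - 1 := by
      rw [card_erase_of_mem (mem_univ j), card_univ, Fintype.card_fin, Nat.cast_sub (by omega),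
        Nat.cast_one]
    -- Pigeonhole: the total slack is at most `3/2 * ε` over `n - 1` states, and `n ≤ 2 * (n - 1)`.
    obtain ⟨l, hl, hlη⟩ : ∃ l ∈ univ.erase j, y l - τ ≤ 3 * ε / n := by
      refine exists_le_of_sum_le (card_pos.mp (by exact_mod_cast hcard ▸ hn1)) ?_
      rw [sum_erase_sub_standardFlower hn hy j, sum_const, nsmul_eq_mul, hcard]
      have : 3 / 2 * ε ≤ (n - 1) * (3 * ε / n) := by
        rw [mul_div_assoc', le_div_iff₀ (by linarith)]
        nlinarith
      linarith
    set p := G.signalProb π s with hp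
    have hjoint : ∀ i, G.joint π (i, s) = p * y i :=
      fun i => G.joint_eq_signalProb_mul_posterior hπ i s
    have hprior : ∀ i, p * y i ≤ 1 / n := fun i => hjoint i ▸ G.joint_le_prior hπ i s
    have hpn : p * n ≤ 3 := by
      have h1 := hprior j
      rw [le_div_iff₀ (by linarith)] at h1
      have h2 := mul_le_mul_of_nonneg_left hyj' (by positivity : 0 ≤ p * n)
      linarith
    have hlτ := hpetal l
    have hτn' : 1 ≤ 2 * n * τ := by linarith
    have hsq : ((k - 1 : ℕ) : ℝ) * (3456 * ε ^ 2) ≤ n ^ 2 := by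
      have h1 : ((k - 1 : ℕ) : ℝ) ≤ k := by exact_mod_cast Nat.sub_le k 1
      rw [div_mul_div_comm, one_mul, lt_div_iff₀ (by positivity)] at hk
      exact (mul_le_mul_of_nonneg_right h1 (by positivity)).trans hk.le
    have hfreq : Real.exp (-11) / 4 ≤ ∑ z : Fin (k - 1) → Fin n × S, (∏ i, G.joint π (z i)) *
        (if ∑ i, ((if z i = (l, s) then 1 else 0) - τ * (if (z i).2 = s then 1 else 0)) ≤ 0
          then 1 else 0) := by
      have hprob : ∑ ω, G.joint π (ω, s) = p := rfl
      refine exp_le_prob_frequency_le (G.joint π) (G.joint_nonneg hπ) (G.sum_joint hπ) s l τ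
        hτ0.le hτ2 ?_ ?_ (k - 1) ?_
      · rw [hprob, hjoint, mul_comm]
        exact mul_le_mul_of_nonneg_left hlτ hs.le
      · rw [hjoint]
        exact (hprior l).trans (one_div_le_one_div_of_le two_pos hn')
      · rw [hprob, hjoint]
        have hp6 : p / 6 ≤ y l := by
          refine le_trans ?_ hlτ
          refine le_of_mul_le_mul_right (a := (n : ℝ)) ?_ (by linarith)
          linarith
        -- The constant is `3456 = 16 * 3 ^ 2 * 24`; the `24` absorbs the `1/4` in the variance
        -- bound and the `1/6` in `hp6`.
        calc 16 * ((k - 1 : ℕ) : ℝ) * (p * y l - τ * p) ^ 2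
            = 16 * ((k - 1 : ℕ) : ℝ) * p ^ 2 * (y l - τ) ^ 2 := by ring
          _ ≤ 16 * ((k - 1 : ℕ) : ℝ) * p ^ 2 * (3 * ε / n) ^ 2 :=
              mul_le_mul_of_nonneg_left (pow_le_pow_left₀ (by linarith) hlη 2) (by positivity)
          _ = p ^ 2 * (((k - 1 : ℕ) : ℝ) * (3456 * ε ^ 2) / n ^ 2) / 24 := by ring
          _ ≤ p ^ 2 * 1 / 24 := by
              have h1 : ((k - 1 : ℕ) : ℝ) * (3456 * ε ^ 2) / n ^ 2 ≤ 1 :=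
                div_le_one_of_le₀ hsq (by positivity)
              gcongr
          _ = p * (p / 6) / 4 := by ring
          _ ≤ p * y l / 4 := by gcongr
    have hest := G.estimateExp_le hπ k hs (f := fun y' => G.senderValue y (act y'))
      (by norm_num : (0 : ℝ) ≤ 1 / 2) hτ0 (fun y' _ => hle (by norm_num) hhalf (act y'))
      (fun y' hy' hlt => ?_) hfreq
    · have h1 : 1 / 2 * Real.exp (-11) ≤ (1 - y l) * Real.exp (-11) :=
        mul_le_mul_of_nonneg_right (by linarith [hhalf l]) (Real.exp_pos _).le
      rw [← hydef] at hest
      linarith [Real.exp_pos (-11)]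
    · cases hi : act y' with
      | inl i => exact absurd ((le_of_act_eq_inl hn hact hy' hi).2 l) (not_le.mpr hlt)
      | inr q => exact (flowerGame_senderValue_inr _ y q).le

end Flower

/-! ### The main theorem. -/

theorem theorem1 :
    -- the maximum of the known-commitment value exists
    (∀ (n : ℕ) [NeZero n], 2 ≤ n →
      ∀ act : (Fin n → ℝ) → FlowerAction n, (standardFlower n).IsReceiverRule act →
        IsGreatest ((standardFlower n).bprValues act) ((standardFlower n).maxBPR act)) ∧
    -- the lower bound on the number of samples
    (∃ c > (0 : ℝ), ∃ ε₀ > (0 : ℝ),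
      ∀ (n : ℕ) [NeZero n], 2 ≤ n →
      ∀ act : (Fin n → ℝ) → FlowerAction n, (standardFlower n).IsReceiverRule act →
      ∀ ε : ℝ, 0 < ε → ε ≤ ε₀ →
      ∀ (S : Type*) [Fintype S] [DecidableEq S] (π : Fin n → S → ℝ), IsScheme π →
        (standardFlower n).BPR act π ≥ (standardFlower n).maxBPR act - ε →
      ∀ k : ℕ, 1 ≤ k →
        (standardFlower n).IR act k π ≥ (standardFlower n).maxBPR act - ε →
        (k : ℝ) ≥ c * (n / (ε ^ 2 * (ε + 1 / n)))) ∧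
    -- the case `ε = 1 / n`
    (∃ c > (0 : ℝ),
      ∀ (n : ℕ) [NeZero n], 2 ≤ n →
      ∀ act : (Fin n → ℝ) → FlowerAction n, (standardFlower n).IsReceiverRule act →
      ∀ (S : Type*) [Fintype S] [DecidableEq S] (π : Fin n → S → ℝ), IsScheme π →
        (standardFlower n).BPR act π ≥ (standardFlower n).maxBPR act - 1 / n →
      ∀ k : ℕ, 1 ≤ k →
        (standardFlower n).IR act k π ≥ (standardFlower n).maxBPR act - 1 / n →
        (k : ℝ) ≥ c * (n : ℝ) ^ 4) := by
  refine ⟨fun n _ hn act hact => ?_, ⟨1 / 3456, by norm_num, Real.exp (-11) / 100, by positivity,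
    fun n _ hn act hact ε hε hε' S _ _ π hπ hB k _ hI => ?_⟩,
    ⟨1 / 3456 * (Real.exp (-11) / 100) ^ 4, by positivity,
      fun n _ hn act hact S _ _ π hπ hB k hk hI => ?_⟩⟩
  · rw [maxBPR_eq_half hn hact]
    exact isGreatest_bprValues hn hact
  · rw [maxBPR_eq_half hn hact] at hB hI
    refine le_trans ?_ (standardFlower_sample_lower_bound hn hact hε hε' hπ hB hI)
    have hn0 : (0 : ℝ) < n := by exact_mod_cast (by omega : 0 < n)
    refine mul_le_mul_of_nonneg_left ?_ (by norm_num)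
    rw [div_le_div_iff₀ (by positivity) (by positivity)]
    calc (n : ℝ) * ε ^ 2 = n ^ 2 * (ε ^ 2 * (1 / n)) := by field_simp
      _ ≤ n ^ 2 * (ε ^ 2 * (ε + 1 / n)) := by gcongr; linarith
  · rw [maxBPR_eq_half hn hact] at hB hI
    have hn0 : (0 : ℝ) < n := by exact_mod_cast (by omega : 0 < n)
    have hexp : Real.exp (-11) ≤ 1 := Real.exp_le_one_iff.mpr (by norm_num)
    have hexp0 := Real.exp_pos (-11)
    -- For bounded `n` the sample bound does not apply, but the fourth power in the constant makes
    -- the claimed bound at most `1`, so `1 ≤ k` suffices.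
    rcases le_or_gt (1 / (n : ℝ)) (Real.exp (-11) / 100) with h | h
    · refine le_trans ?_
        (standardFlower_sample_lower_bound hn hact (by positivity) h hπ hB hI)
      have h1 : (Real.exp (-11) / 100) ^ 4 ≤ 1 := pow_le_one₀ (by positivity) (by linarith)
      calc 1 / 3456 * (Real.exp (-11) / 100) ^ 4 * (n : ℝ) ^ 4
          ≤ 1 / 3456 * 1 * (n : ℝ) ^ 4 := by gcongr
        _ = 1 / 3456 * ((n : ℝ) ^ 2 / (1 / n) ^ 2) := by field_simp
    · have h1 : Real.exp (-11) / 100 * n ≤ 1 := by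
        rw [lt_div_iff₀ hn0] at h
        exact h.le
      have h2 : (Real.exp (-11) / 100 * n) ^ 4 ≤ 1 := pow_le_one₀ (by positivity) h1
      have h3 : (1 : ℝ) ≤ k := by exact_mod_cast hk
      rw [mul_pow] at h2
      linarith
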